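/- Let $\mathcal H$ be a complex Hilbert space with inner product linear in the second argument, and let $K$ be a bounded and boundedly invertible operator on $\mathcal H$. An operator $T$ in $\mathcal H$ is called $K$-invariant if $K^*TK=T$, including equality of domains, where $\mathcal D(K^*TK)=\{f : Kf\in\mathcal D(T)\}$. Let $S$ be a densely defined, closed, symmetric operator in $\mathcal H$ that is strictly positive (there is $\varepsilon>0$ with $\langle f,Sf\rangle\ge\varepsilon\|f\|^2$ for all $f\in\mathcal D(S)$) and $K$-invariant, and assume that $\dim\ker(S^*)<\infty$. Let $S_F$ be the Friedrichs extension of $S$, i.e. the restriction of $S^*$ to the set of all $f\in\mathcal D(S^*)$ for which there is a sequence $(f_n)$ in $\mathcal D(S)$ with $f_n\to f$ and $\langle f_n-f_m,S(f_n-f_m)\rangle\to0$ as $n,m\to\infty$. Let $B$ be an operator with $\overline{\mathcal D(B)}\subseteq\ker(S^*)$ that is nonnegative and self-adjoint in the Hilbert space $\overline{\mathcal D(B)}$, and let $S_B$ be the corresponding nonnegative self-adjoint extension of $S$, i.e. the restriction of $S^*$ to $$\mathcal D(S_B)=\mathcal D(S)+\{S_F^{-1}Bf+f : f\in\mathcal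 D(B)\}+\{S_F^{-1}\eta : \eta\in\mathcal D(B)^\perp\cap\ker(S^*)\}.$$ If $S_B$ is $K$-invariant, then $K\mathcal D(B)\subseteq\mathcal D(B)$, so that $\widetilde K:=K\upharpoonright_{\mathcal D(B)}$ is a linear map of $\mathcal D(B)$ into itself, and $$\mathcal C:=\operatorname{span}\bigl\{\mathcal R(\zeta,\widetilde K) : \zeta\in\sigma(\widetilde K),\ |\zeta|\ne1\bigr\}\subseteq\ker(B),$$ where $\mathcal R(\zeta,\widetilde K)=\{\eta\in\mathcal D(B) : (\widetilde K-\zeta)^n\eta=0\text{ for some }n\in\mathbb N\}$. -/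

import Mathlib

namespace KInvExt

open Filter
open scoped Topology InnerProductSpace LinearPMap

/-- `⟨f, T f⟩` for `f ∈ D(T)`; the real part is the whole value when `T` is symmetric. -/
noncomputable def quadForm {H : Type*} [NormedAddCommGroup H] [InnerProductSpace ℂ H]
    (T : H →ₗ.[ℂ] H) (f : T.domain) : ℝ :=
  (⟪(f : H), T f⟫_ℂ).re

/-- `T` is a densely defined symmetric operator. -/
structure IsSymmetricOp {H : Type*} [NormedAddCommGroup H] [InnerProductSpace ℂ H]
    (T : H →ₗ.[ℂ] H) : Prop where
  dense : Dense (T.domain : Set H)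
  symm : ∀ f g : T.domain, ⟪T f, (g : H)⟫_ℂ = ⟪(f : H), T g⟫_ℂ

/-- `T ≥ 0`. -/
def IsNonneg {H : Type*} [NormedAddCommGroup H] [InnerProductSpace ℂ H]
    (T : H →ₗ.[ℂ] H) : Prop :=
  ∀ f : T.domain, 0 ≤ quadForm T f

/-- `T ≥ ε I` for some `ε > 0`. -/
def IsStrictlyPositive {H : Type*} [NormedAddCommGroup H] [InnerProductSpace ℂ H]
    (T : H →ₗ.[ℂ] H) : Prop :=
  ∃ ε : ℝ, 0 < ε ∧ ∀ f : T.domain, ε * ‖(f : H)‖ ^ 2 ≤ quadForm T f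

theorem IsStrictlyPositive.isNonneg {H : Type*} [NormedAddCommGroup H] [InnerProductSpace ℂ H]
    {T : H →ₗ.[ℂ] H} (h : IsStrictlyPositive T) : IsNonneg T := by
  obtain ⟨ε, hε, h⟩ := h
  exact fun f => le_trans (by positivity) (h f)

/-- The kernel of a partially defined operator, as a subspace of the ambient space. -/
def kernel {H : Type*} [NormedAddCommGroup H] [InnerProductSpace ℂ H]
    (T : H →ₗ.[ℂ] H) : Submodule ℂ H :=
  (LinearMap.ker T.toFun).map T.domain.subtype

/-- The operator `K* T K` on its natural domain `{f | K f ∈ D(T)}`. -/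
noncomputable def conjOp {H : Type*} [NormedAddCommGroup H] [InnerProductSpace ℂ H]
    [CompleteSpace H] (K : H →L[ℂ] H) (T : H →ₗ.[ℂ] H) : H →ₗ.[ℂ] H where
  domain := T.domain.comap (K : H →ₗ[ℂ] H)
  toFun := (K.adjoint : H →ₗ[ℂ] H) ∘ₗ T.toFun ∘ₗ
    ((K : H →ₗ[ℂ] H).restrict (p := T.domain.comap (K : H →ₗ[ℂ] H)) (q := T.domain)
      fun _ hf => hf)

/-- `T` is `K`-invariant: `K* T K = T`, domains included. -/
def KInvariant {H : Type*} [NormedAddCommGroup H] [InnerProductSpace ℂ H]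
    [CompleteSpace H] (K : H ≃L[ℂ] H) (T : H →ₗ.[ℂ] H) : Prop :=
  conjOp (K : H →L[ℂ] H) T = T

theorem quadForm_add_le {H : Type*} [NormedAddCommGroup H] [InnerProductSpace ℂ H]
    {T : H →ₗ.[ℂ] H} (h : IsNonneg T) (f g : T.domain) :
    quadForm T (f + g) ≤ 2 * quadForm T f + 2 * quadForm T g := by
  have h1 := h (f - g)
  simp only [quadForm, LinearPMap.map_sub, LinearPMap.map_add, Submodule.coe_sub,
    Submodule.coe_add, inner_sub_left, inner_sub_right, inner_add_left, inner_add_right,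
    Complex.sub_re, Complex.add_re] at h1 ⊢
  linarith

theorem quadForm_smul {H : Type*} [NormedAddCommGroup H] [InnerProductSpace ℂ H]
    (T : H →ₗ.[ℂ] H) (c : ℂ) (f : T.domain) :
    quadForm T (c • f) = ‖c‖ ^ 2 * quadForm T f := by
  simp only [quadForm, LinearPMap.map_smul, Submodule.coe_smul, inner_smul_left,
    inner_smul_right, ← mul_assoc, Complex.mul_conj']
  rw [← Complex.ofReal_pow, Complex.re_ofReal_mul]

/-- Domain of the Friedrichs extension of a nonnegative symmetric `S`: those `f ∈ D(S*)` that are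
limits of sequences in `D(S)` which are Cauchy for the quadratic form of `S`. -/
noncomputable def friedrichsDomain {H : Type*} [NormedAddCommGroup H] [InnerProductSpace ℂ H]
    [CompleteSpace H] (S : H →ₗ.[ℂ] H) (hS : IsNonneg S) : Submodule ℂ H where
  carrier := {f | f ∈ S†.domain ∧ ∃ u : ℕ → S.domain,
    Tendsto (fun n => (u n : H)) atTop (𝓝 f) ∧
    Tendsto (fun p : ℕ × ℕ => quadForm S (u p.1 - u p.2)) (atTop ×ˢ atTop) (𝓝 0)}
  zero_mem' := ⟨zero_mem _, fun _ => 0, by simp, by simp [quadForm]⟩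
  add_mem' := by
    rintro f g ⟨hf, u, hu, hu'⟩ ⟨hg, v, hv, hv'⟩
    refine ⟨add_mem hf hg, fun n => u n + v n, by simpa using hu.add hv, ?_⟩
    refine squeeze_zero (fun p => hS _) (fun p => ?_)
      (by simpa using (hu'.const_mul 2).add (hv'.const_mul 2))
    rw [add_sub_add_comm]
    exact quadForm_add_le hS _ _
  smul_mem' := by
    rintro c f ⟨hf, u, hu, hu'⟩
    refine ⟨Submodule.smul_mem _ c hf, fun n => c • u n, by simpa using hu.const_smul c, ?_⟩
    simp only [← smul_sub, quadForm_smul]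
    simpa using hu'.const_mul (‖c‖ ^ 2)

/-- The Friedrichs extension `S_F`, the restriction of `S*` to `friedrichsDomain`. -/
noncomputable def friedrichs {H : Type*} [NormedAddCommGroup H] [InnerProductSpace ℂ H]
    [CompleteSpace H] (S : H →ₗ.[ℂ] H) (hS : IsNonneg S) : H →ₗ.[ℂ] H where
  domain := friedrichsDomain S hS
  toFun := S†.toFun ∘ₗ Submodule.inclusion fun _ hf => hf.1

/-- An operator `B` in `H` whose values lie in the closure of `D(B)`, regarded as an operator in
the Hilbert space `closure D(B)`. -/
def inClosure {H : Type*} [NormedAddCommGroup H] [InnerProductSpace ℂ H]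
    (B : H →ₗ.[ℂ] H) (hB : ∀ f : B.domain, B f ∈ B.domain.topologicalClosure) :
    B.domain.topologicalClosure →ₗ.[ℂ] B.domain.topologicalClosure where
  domain := B.domain.comap B.domain.topologicalClosure.subtype
  toFun := (B.toFun.codRestrict B.domain.topologicalClosure hB) ∘ₗ
    (B.domain.topologicalClosure.subtype.restrict
      (p := B.domain.comap B.domain.topologicalClosure.subtype) (q := B.domain) fun _ hf => hf)

/-- `B` is an auxiliary operator for `S`: a nonnegative self-adjoint operator in the Hilbert space
`closure D(B)`, which is contained in `ker S*`. -/
structure IsAuxiliary {H : Type*} [NormedAddCommGroup H] [InnerProductSpace ℂ H]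
    [CompleteSpace H] (S B : H →ₗ.[ℂ] H) : Prop where
  closure_le : B.domain.topologicalClosure ≤ kernel S†
  map_mem : ∀ f : B.domain, B f ∈ B.domain.topologicalClosure
  selfAdjoint : IsSelfAdjoint (inClosure B map_mem)
  nonneg : IsNonneg B

/-- The domain
`D(S_B) = D(S) + {S_F⁻¹ B f + f | f ∈ D(B)} + {S_F⁻¹ η | η ∈ D(B)ᗮ ∩ ker S*}`. Here `u` and `v` are
`S_F⁻¹ B f` and `S_F⁻¹ η`, that is, the elements of `D(S_F)` with `S_F u = B f` and `S_F v = η`. -/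
noncomputable def extDomain {H : Type*} [NormedAddCommGroup H] [InnerProductSpace ℂ H]
    [CompleteSpace H] (S : H →ₗ.[ℂ] H) (hS : IsNonneg S) (B : H →ₗ.[ℂ] H) : Submodule ℂ H where
  carrier := {ψ | ∃ (f₀ : S.domain) (f : B.domain) (η : H) (u v : (friedrichs S hS).domain),
    η ∈ B.domainᗮ ⊓ kernel S† ∧ friedrichs S hS u = B f ∧ friedrichs S hS v = η ∧
    ψ = f₀ + (u + f) + v}
  zero_mem' := ⟨0, 0, 0, 0, 0, zero_mem _, by simp, by simp, by simp⟩
  add_mem' := by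
    rintro _ _ ⟨f₀, f, η, u, v, h1, h2, h3, rfl⟩ ⟨f₀', f', η', u', v', h1', h2', h3', rfl⟩
    refine ⟨f₀ + f₀', f + f', η + η', u + u', v + v', add_mem h1 h1', ?_, ?_, ?_⟩
    · rw [LinearPMap.map_add, LinearPMap.map_add, h2, h2']
    · rw [LinearPMap.map_add, h3, h3']
    · push_cast; abel
  smul_mem' := by
    rintro c _ ⟨f₀, f, η, u, v, h1, h2, h3, rfl⟩
    refine ⟨c • f₀, c • f, c • η, c • u, c • v, Submodule.smul_mem _ c h1, ?_, ?_, ?_⟩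
    · rw [LinearPMap.map_smul, LinearPMap.map_smul, h2]
    · rw [LinearPMap.map_smul, h3]
    · push_cast; simp only [smul_add]

/-- The extension `S_B` of `S`: the restriction of `S*` to `D(S_B)`, which is contained in `D(S*)`
whenever `S` is symmetric and `D(B) ⊆ ker S*`. -/
noncomputable def extOp {H : Type*} [NormedAddCommGroup H] [InnerProductSpace ℂ H]
    [CompleteSpace H] (S : H →ₗ.[ℂ] H) (hS : IsNonneg S) (B : H →ₗ.[ℂ] H) : H →ₗ.[ℂ] H :=
  S†.domRestrict (extDomain S hS B)

theorem extOp_domain {H : Type*} [NormedAddCommGroup H] [InnerProductSpace ℂ H]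
    [CompleteSpace H] {S : H →ₗ.[ℂ] H} (hsymm : IsSymmetricOp S) (hS : IsNonneg S)
    {B : H →ₗ.[ℂ] H} (hB : IsAuxiliary S B) :
    (extOp S hS B).domain = extDomain S hS B := by
  refine inf_eq_left.mpr ?_
  rintro _ ⟨f₀, f, η, u, v, -, -, -, rfl⟩
  have hker : kernel S† ≤ S†.domain := by
    rintro _ ⟨x, -, rfl⟩
    exact x.2
  have hle : S ≤ S† := LinearPMap.IsFormalAdjoint.le_adjoint hsymm.dense hsymm.symm
  exact add_mem (add_mem (hle.1 f₀.2) (add_mem u.2.1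
    (hker (hB.closure_le (Submodule.le_topologicalClosure _ f.2))))) v.2.1

/-- The sum of the root spaces `{η | ∃ n, (A - ζ)ⁿ η = 0}` of `A` over all `ζ ∈ σ(A)`
with `|ζ| ≠ 1`. -/
noncomputable def nonunitaryRootSpan {V : Type*} [AddCommGroup V] [Module ℂ V]
    (A : Module.End ℂ V) : Submodule ℂ V :=
  ⨆ ζ ∈ {ζ : ℂ | ζ ∈ spectrum ℂ A ∧ ‖ζ‖ ≠ 1}, A.maxGenEigenspace ζ

end KInvExt

namespace KInvExt

open Filter
open scoped Topology InnerProductSpace LinearPMap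

/-! ### Nonnegative symmetric forms. -/

section Basic

variable {H : Type*} [NormedAddCommGroup H] [InnerProductSpace ℂ H]

/-! Let `f ∈ D(B)` and `u = S_F⁻¹ B f`, so that `u + f ∈ D(S_B)`. Invariance puts `K u + K f` in
`D(S_B)`. Since `K` preserves both `D(S_F)` and `ker S*`, and these meet only in `0`, the `ker S*`
components must agree: `K f ∈ D(B)`. Moreover `S* K u = (K⁻¹)* B f`; pairing this with `K g ∈ D(B)`
gives `⟨K g, B K f⟩ = ⟨g, B f⟩`, so `K` preserves the form of `B` (`IsAuxiliary.exists_inner_map`).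

An eigenvector `f` for `ζ` then satisfies `⟨f, B f⟩ = |ζ|² ⟨f, B f⟩`. If `|ζ| ≠ 1` the form vanishes
at `f`, and nonnegativity forces `B f = 0`. Root vectors follow by induction on their height
(`IsAuxiliary.apply_eq_zero_of_pow`). -/

theorem mem_kernel {T : H →ₗ.[ℂ] H} {x : H} :
    x ∈ kernel T ↔ ∃ h : x ∈ T.domain, T ⟨x, h⟩ = 0 := by
  constructor
  · rintro ⟨y, hy, rfl⟩
    exact ⟨y.2, hy⟩
  · rintro ⟨h, hx⟩
    exact ⟨⟨x, h⟩, hx, rfl⟩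

/-- The polarised expansion of the quadratic form along a real line. -/
theorem quadForm_add_real_smul {T : H →ₗ.[ℂ] H}
    (hT : ∀ f g : T.domain, ⟪T f, (g : H)⟫_ℂ = ⟪(f : H), T g⟫_ℂ) (f g : T.domain) (t : ℝ) :
    quadForm T (f + (t : ℂ) • g) =
      quadForm T f + 2 * t * (⟪(f : H), T g⟫_ℂ).re + t ^ 2 * quadForm T g := by
  have h : (⟪(g : H), T f⟫_ℂ).re = (⟪(f : H), T g⟫_ℂ).re := by
    rw [← hT f g, ← inner_conj_symm, Complex.conj_re]
  simp only [quadForm, LinearPMap.map_add, LinearPMap.map_smul, Submodule.coe_add,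
    Submodule.coe_smul, inner_add_left, inner_add_right, inner_smul_left, inner_smul_right,
    Complex.add_re, Complex.conj_ofReal, Complex.re_ofReal_mul, h]
  ring

theorem quadForm_sub {T : H →ₗ.[ℂ] H}
    (hT : ∀ f g : T.domain, ⟪T f, (g : H)⟫_ℂ = ⟪(f : H), T g⟫_ℂ) (f g : T.domain) :
    quadForm T (f - g) = quadForm T f - 2 * (⟪(f : H), T g⟫_ℂ).re + quadForm T g := by
  have h := quadForm_add_real_smul hT f g (-1)
  have e : f + ((-1 : ℝ) : ℂ) • g = f - g := by simp [sub_eq_add_neg]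
  rw [e] at h
  rw [h]
  ring

/-- An affine function of `t`, plus a quadratic term and a nonnegative constant, that stays
nonnegative has a small slope. -/
theorem sq_le_mul_of_forall_quadratic_nonneg {a b c : ℝ}
    (h : ∀ t : ℝ, 0 ≤ c + 2 * t * b + t ^ 2 * a) : b ^ 2 ≤ a * c := by
  have h' := discrim_le_zero (a := a) (b := 2 * b) (c := c) fun x => by
    have := h x
    nlinarith
  rw [discrim] at h'
  nlinarith

/-- The kernel of a nonnegative form is its set of null vectors. -/
theorem inner_eq_zero_of_quadForm_eq_zero {T : H →ₗ.[ℂ] H}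
    (hT : ∀ f g : T.domain, ⟪T f, (g : H)⟫_ℂ = ⟪(f : H), T g⟫_ℂ) (hpos : IsNonneg T)
    {g : T.domain} (hg : quadForm T g = 0) (f : T.domain) : ⟪(f : H), T g⟫_ℂ = 0 := by
  have key : ∀ f : T.domain, (⟪(f : H), T g⟫_ℂ).re = 0 := fun f => by
    have := sq_le_mul_of_forall_quadratic_nonneg (fun t => by
      have := hpos (f + (t : ℂ) • g)
      rwa [quadForm_add_real_smul hT] at this)
    rw [hg, zero_mul] at this
    exact pow_eq_zero_iff two_ne_zero |>.1 (le_antisymm this (sq_nonneg _))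
  refine Complex.ext (key f) ?_
  -- Replacing `f` by `i f` turns the imaginary part into a real part.
  have := key (Complex.I • f)
  simpa [inner_smul_left] using this

end Basic

/-! ### Bijectivity of the Friedrichs extension. -/

section Friedrichs

variable {H : Type*} [NormedAddCommGroup H] [InnerProductSpace ℂ H] [CompleteSpace H]

theorem domain_le_friedrichsDomain {S : H →ₗ.[ℂ] H} (hsymm : IsSymmetricOp S)
    (hS : IsNonneg S) : S.domain ≤ friedrichsDomain S hS := fun f hf =>
  ⟨(LinearPMap.IsFormalAdjoint.le_adjoint hsymm.dense hsymm.symm).1 hf,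
    fun _ => ⟨f, hf⟩, tendsto_const_nhds, by simp [quadForm]⟩

/-- The Friedrichs extension of a strictly positive operator is injective. -/
theorem eq_zero_of_mem_friedrichsDomain_of_mem_kernel {S : H →ₗ.[ℂ] H}
    (hsymm : IsSymmetricOp S) (hpos : IsStrictlyPositive S) {f : H}
    (hf : f ∈ friedrichsDomain S hpos.isNonneg) (hker : f ∈ kernel S†) : f = 0 := by
  obtain ⟨-, u, hu, hu'⟩ := hf
  obtain ⟨hd, hz⟩ := mem_kernel.1 hker
  obtain ⟨ε, hε, hpos'⟩ := hpos
  have hpos : IsNonneg S := IsStrictlyPositive.isNonneg ⟨ε, hε, hpos'⟩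
  -- The limit is `⟨f, S u_m⟩ = ⟨S* f, u_m⟩ = 0`.
  have hlim (m : ℕ) : Tendsto (fun n => (⟪(u n : H), S (u m)⟫_ℂ).re) atTop (𝓝 0) := by
    have h1 : Tendsto (fun n => ⟪(u n : H), S (u m)⟫_ℂ) atTop (𝓝 ⟪f, S (u m)⟫_ℂ) :=
      hu.inner tendsto_const_nhds
    have h2 := LinearPMap.adjoint_isFormalAdjoint hsymm.dense ⟨f, hd⟩ (u m)
    rw [hz, inner_zero_left] at h2
    rw [← h2] at h1
    exact (Complex.continuous_re.tendsto _).comp h1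
  have hq : Tendsto (fun m => quadForm S (u m)) atTop (𝓝 0) := by
    rw [Metric.tendsto_atTop]
    intro δ hδ
    rw [prod_atTop_atTop_eq] at hu'
    obtain ⟨⟨N₁, N₂⟩, hN⟩ := eventually_atTop.1 (hu'.eventually (gt_mem_nhds (half_pos hδ)))
    refine ⟨N₂, fun m hm => ?_⟩
    -- Expand the form at `u_n - u_m`, drop its nonnegative value at `u_n`, and let `n → ∞` in the
    -- cross term.
    have hle : quadForm S (u m) - 2 * 0 ≤ δ / 2 := by
      refine le_of_tendsto (((hlim m).const_mul 2).const_sub (quadForm S (u m)))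
        (eventually_atTop.2 ⟨N₁, fun n hn => ?_⟩)
      have h1 := hN (n, m) ⟨hn, hm⟩
      have h2 := hpos (u n)
      rw [quadForm_sub hsymm.symm] at h1
      linarith
    rw [Real.dist_0_eq_abs, abs_of_nonneg (hpos _)]
    linarith
  have hn : Tendsto (fun m => ‖(u m : H)‖ ^ 2) atTop (𝓝 0) := by
    refine squeeze_zero (fun _ => by positivity) (fun m => ?_) (by simpa using hq.const_mul ε⁻¹)
    rw [le_inv_mul_iff₀ hε]
    exact hpos' _
  have := tendsto_nhds_unique (hu.norm.pow 2) hn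
  simpa using this

/-- The Friedrichs extension of a strictly positive operator is surjective: a minimising sequence
of `f ↦ ⟨f, S f⟩ - 2 Re ⟨h, f⟩` converges to a preimage of `h`. -/
theorem exists_friedrichs_eq {S : H →ₗ.[ℂ] H} (hsymm : IsSymmetricOp S)
    (hpos : IsStrictlyPositive S) (h : H) :
    ∃ u : (friedrichs S hpos.isNonneg).domain, friedrichs S hpos.isNonneg u = h := by
  obtain ⟨ε, hε, hpos'⟩ := id hpos
  set J : S.domain → ℝ := fun f => quadForm S f - 2 * (⟪h, (f : H)⟫_ℂ).re with hJ
  have hbdd : BddBelow (Set.range J) := by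
    -- The minimum of `ε t² - 2 ‖h‖ t`, found by completing the square.
    refine ⟨-(ε⁻¹ * ‖h‖ ^ 2), ?_⟩
    rintro _ ⟨f, rfl⟩
    have h1 := hpos' f
    have h2 : (⟪h, (f : H)⟫_ℂ).re ≤ ‖h‖ * ‖(f : H)‖ := re_inner_le_norm (𝕜 := ℂ) h (f : H)
    have h3 : 0 ≤ ε⁻¹ * (ε * ‖(f : H)‖ - ‖h‖) ^ 2 := by positivity
    have h4 : ε⁻¹ * (ε * ‖(f : H)‖ - ‖h‖) ^ 2 =
        ε * ‖(f : H)‖ ^ 2 - 2 * (‖h‖ * ‖(f : H)‖) + ε⁻¹ * ‖h‖ ^ 2 := by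
      field_simp
      ring
    simp only [hJ]
    linarith
  set m := ⨅ f, J f with hm
  have hle (f : S.domain) : m ≤ J f := ciInf_le hbdd f
  obtain ⟨a, ha, hau⟩ : ∃ a : ℕ → ℝ, Tendsto a atTop (𝓝 0) ∧ ∀ n, 0 < a n :=
    ⟨fun n => 1 / ((n : ℝ) + 1), tendsto_one_div_add_atTop_nhds_zero_nat, fun n => by positivity⟩
  have hex (n : ℕ) : ∃ f, J f < m + a n := exists_lt_of_ciInf_lt (by linarith [hau n])
  choose u hu using hex
  -- Parallelogram law, with `J ≥ m` at the midpoint of `f` and `g`.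
  have hpar (f g : S.domain) : quadForm S (f - g) ≤ 2 * (J f - m) + 2 * (J g - m) := by
    have h1 := hle (((1 / 2 : ℝ) : ℂ) • (f + g))
    have h2 := quadForm_add_real_smul hsymm.symm f g 1
    have h3 := quadForm_sub hsymm.symm f g
    rw [Complex.ofReal_one, one_smul] at h2
    simp only [hJ, quadForm_smul, Submodule.coe_smul, Submodule.coe_add, inner_smul_right,
      inner_add_right, Complex.re_ofReal_mul, Complex.add_re, Complex.norm_real, Real.norm_eq_abs,
      sq_abs] at h1 ⊢
    rw [h2] at h1
    linarith
  have ha1 : Tendsto (fun p : ℕ × ℕ => 2 * a p.1 + 2 * a p.2) (atTop ×ˢ atTop) (𝓝 0) := by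
    simpa using ((ha.comp tendsto_fst).const_mul 2).add ((ha.comp tendsto_snd).const_mul 2)
  have hcauchy : Tendsto (fun p : ℕ × ℕ => quadForm S (u p.1 - u p.2)) (atTop ×ˢ atTop)
      (𝓝 0) :=
    squeeze_zero (fun _ => hpos.isNonneg _)
      (fun p => (hpar _ _).trans (by linarith [hu p.1, hu p.2])) ha1
  have hcs : CauchySeq fun n => (u n : H) := by
    rw [cauchySeq_iff_tendsto_dist_atTop_0, ← prod_atTop_atTop_eq]
    have h1 : Tendsto (fun p : ℕ × ℕ => √(ε⁻¹ * quadForm S (u p.1 - u p.2)))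
        (atTop ×ˢ atTop) (𝓝 0) := by
      simpa using (hcauchy.const_mul ε⁻¹).sqrt
    refine squeeze_zero (fun _ => dist_nonneg) (fun p => Real.le_sqrt_of_sq_le ?_) h1
    rw [le_inv_mul_iff₀ hε, dist_eq_norm]
    exact hpos' (u p.1 - u p.2)
  obtain ⟨f, hf⟩ := cauchySeq_tendsto_of_complete hcs
  have hre (g : S.domain) : (⟪f, S g⟫_ℂ).re = (⟪h, (g : H)⟫_ℂ).re := by
    -- Approximate Euler–Lagrange equation: `J (u n + t g) ≥ m > J (u n) - a n` for all real `t`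
    -- makes a quadratic in `t` with constant term `a n` nonnegative, so its discriminant bounds the
    -- slope.
    have h1 (n : ℕ) : ((⟪(u n : H), S g⟫_ℂ).re - (⟪h, (g : H)⟫_ℂ).re) ^ 2 ≤
        quadForm S g * a n := by
      refine sq_le_mul_of_forall_quadratic_nonneg fun t => ?_
      have h2 := hle (u n + (t : ℂ) • g)
      have h3 := hu n
      simp only [hJ, quadForm_add_real_smul hsymm.symm, Submodule.coe_smul, Submodule.coe_add,
        inner_smul_right, inner_add_right, Complex.re_ofReal_mul, Complex.add_re] at h2 h3
      linarith
    have h4 : Tendsto (fun n => ((⟪(u n : H), S g⟫_ℂ).re - (⟪h, (g : H)⟫_ℂ).re) ^ 2) atTop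
        (𝓝 (((⟪f, S g⟫_ℂ).re - (⟪h, (g : H)⟫_ℂ).re) ^ 2)) :=
      (((Complex.continuous_re.tendsto _).comp
        (hf.inner tendsto_const_nhds)).sub_const _).pow 2
    have h5 := tendsto_nhds_unique h4
      (squeeze_zero (fun _ => sq_nonneg _) h1 (by simpa using ha.const_mul (quadForm S g)))
    exact sub_eq_zero.1 (pow_eq_zero_iff two_ne_zero |>.1 h5)
  have hin (g : S.domain) : ⟪h, (g : H)⟫_ℂ = ⟪f, S g⟫_ℂ := by
    refine Complex.ext (hre g).symm ?_
    have := hre (Complex.I • g)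
    simpa [LinearPMap.map_smul, inner_smul_right] using this.symm
  have hmem : f ∈ S†.domain := LinearPMap.mem_adjoint_domain_of_exists _ ⟨h, hin⟩
  exact ⟨⟨f, hmem, u, hf, hcauchy⟩,
    LinearPMap.adjoint_apply_eq hsymm.dense ⟨f, hmem⟩ hin⟩

end Friedrichs

/-! ### Consequences of `K`-invariance for the adjoint and the Friedrichs domain. -/

section Invariance

variable {H : Type*} [NormedAddCommGroup H] [InnerProductSpace ℂ H] [CompleteSpace H]

theorem KInvariant.mem_domain_iff {K : H ≃L[ℂ] H} {T : H →ₗ.[ℂ] H} (hK : KInvariant K T)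
    (f : H) : K f ∈ T.domain ↔ f ∈ T.domain := by
  have : (conjOp (K : H →L[ℂ] H) T).domain = T.domain := congrArg LinearPMap.domain hK
  exact (iff_of_eq (congrArg (f ∈ ·) this))

theorem KInvariant.adjoint_apply {K : H ≃L[ℂ] H} {T : H →ₗ.[ℂ] H} (hK : KInvariant K T)
    (f : T.domain) (hf : K f ∈ T.domain) :
    (K : H →L[ℂ] H).adjoint (T ⟨K f, hf⟩) = T f := by
  have h : conjOp (K : H →L[ℂ] H) T ≤ T := le_of_eq hK
  exact h.2 (x := ⟨f, hf⟩) (y := f) rfl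

theorem KInvariant.inner_map {K : H ≃L[ℂ] H} {T : H →ₗ.[ℂ] H} (hK : KInvariant K T)
    (g : H) (f : T.domain) (hf : K f ∈ T.domain) : ⟪K g, T ⟨K f, hf⟩⟫_ℂ = ⟪g, T f⟫_ℂ := by
  rw [← hK.adjoint_apply f hf, ContinuousLinearMap.adjoint_inner_right]
  rfl

/-- Formally, `T* = K* T* K` follows by taking adjoints in `T = K* T K`. The proof tests against `x
= K (K⁻¹ x)`, where `K⁻¹ x ∈ D(T)` by invariance. -/
theorem KInvariant.adjoint {K : H ≃L[ℂ] H} {T : H →ₗ.[ℂ] H} (hK : KInvariant K T)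
    (hT : Dense (T.domain : Set H)) (f : T†.domain) :
    ∃ hf : K f ∈ T†.domain,
      T† ⟨K f, hf⟩ = ((K.symm : H ≃L[ℂ] H) : H →L[ℂ] H).adjoint (T† f) := by
  have key (x : T.domain) :
      ⟪((K.symm : H ≃L[ℂ] H) : H →L[ℂ] H).adjoint (T† f), (x : H)⟫_ℂ = ⟪K f, T x⟫_ℂ := by
    have hx : K (K.symm x) ∈ T.domain := by simp
    have h1 := hK.inner_map (f : H) ⟨K.symm x, (hK.mem_domain_iff _).1 hx⟩ hx
    have h2 : (⟨K (K.symm x), hx⟩ : T.domain) = x := Subtype.ext (by simp)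
    simp only [h2] at h1
    rw [h1, ContinuousLinearMap.adjoint_inner_left]
    exact LinearPMap.adjoint_isFormalAdjoint hT f ⟨K.symm x, _⟩
  have hmem : K f ∈ T†.domain := LinearPMap.mem_adjoint_domain_of_exists _ ⟨_, key⟩
  exact ⟨hmem, LinearPMap.adjoint_apply_eq hT ⟨K f, hmem⟩ key⟩

theorem KInvariant.map_mem_kernel_adjoint {K : H ≃L[ℂ] H} {T : H →ₗ.[ℂ] H}
    (hK : KInvariant K T) (hT : Dense (T.domain : Set H)) {f : H} (hf : f ∈ kernel T†) :
    K f ∈ kernel T† := by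
  obtain ⟨hd, hz⟩ := mem_kernel.1 hf
  obtain ⟨hd', h⟩ := hK.adjoint hT ⟨f, hd⟩
  exact mem_kernel.2 ⟨hd', by rw [h, hz, map_zero]⟩

/-- `K` is continuous and isometric for the form of `S`, so it carries an approximating form-Cauchy
sequence to another one. -/
theorem KInvariant.map_mem_friedrichsDomain {K : H ≃L[ℂ] H} {S : H →ₗ.[ℂ] H}
    (hK : KInvariant K S) (hsymm : IsSymmetricOp S) (hS : IsNonneg S) {f : H}
    (hf : f ∈ friedrichsDomain S hS) : K f ∈ friedrichsDomain S hS := by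
  obtain ⟨hd, u, hu, hu'⟩ := hf
  refine ⟨(hK.adjoint hsymm.dense ⟨f, hd⟩).1,
    fun n => ⟨K (u n), (hK.mem_domain_iff _).2 (u n).2⟩,
    (K.continuous.tendsto f).comp hu, ?_⟩
  refine hu'.congr fun p => ?_
  have h1 := hK.inner_map (u p.1 - u p.2 : S.domain) (u p.1 - u p.2)
    ((hK.mem_domain_iff _).2 (u p.1 - u p.2).2)
  have h2 : (⟨K (u p.1), (hK.mem_domain_iff _).2 (u p.1).2⟩ -
      ⟨K (u p.2), (hK.mem_domain_iff _).2 (u p.2).2⟩ : S.domain) =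
      ⟨K (u p.1 - u p.2 : S.domain), (hK.mem_domain_iff _).2 (u p.1 - u p.2).2⟩ :=
    Subtype.ext (by simp)
  rw [quadForm, quadForm, h2, ← h1]

end Invariance

/-! ### The form of `B` and its invariance under `K`. -/

section Auxiliary

variable {H : Type*} [NormedAddCommGroup H] [InnerProductSpace ℂ H] [CompleteSpace H]
  {S B : H →ₗ.[ℂ] H}

theorem IsAuxiliary.mem_kernel_adjoint (hB : IsAuxiliary S B) (f : B.domain) :
    (f : H) ∈ kernel S† :=
  hB.closure_le (Submodule.le_topologicalClosure _ f.2)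

/-- `D(B)` need not be dense in `H`, so symmetry is read off from self-adjointness in its closure,
where it is dense. -/
theorem IsAuxiliary.symm (hB : IsAuxiliary S B) (f g : B.domain) :
    ⟪B f, (g : H)⟫_ℂ = ⟪(f : H), B g⟫_ℂ := by
  set A := inClosure B hB.map_mem with hA
  have hdense : Dense (A.domain : Set B.domain.topologicalClosure) := by
    intro x
    rw [closure_subtype]
    refine closure_mono ?_ x.2
    intro y hy
    exact ⟨⟨y, Submodule.le_topologicalClosure _ hy⟩, hy, rfl⟩
  have h := LinearPMap.adjoint_isFormalAdjoint hdense
  have hself : A† = A := hB.selfAdjoint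
  rw [hself] at h
  exact h ⟨⟨f, Submodule.le_topologicalClosure _ f.2⟩, f.2⟩
    ⟨⟨g, Submodule.le_topologicalClosure _ g.2⟩, g.2⟩

/-- `B f` is orthogonal to `D(B)`, hence to its closure, which contains `B f`. -/
theorem IsAuxiliary.apply_eq_zero (hB : IsAuxiliary S B) {f : B.domain}
    (hf : quadForm B f = 0) : B f = 0 := by
  have h1 : B f ∈ B.domain.topologicalClosureᗮ := by
    rw [Submodule.orthogonal_closure]
    exact (Submodule.mem_orthogonal _ _).2 fun g hg =>
      inner_eq_zero_of_quadForm_eq_zero hB.symm hB.nonneg hf ⟨g, hg⟩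
  exact inner_self_eq_zero.1 ((Submodule.mem_orthogonal _ _).1 h1 _ (hB.map_mem f))

/-- If `S_B` is `K`-invariant then `K` preserves `D(B)` and the sesquilinear form of `B`. -/
theorem IsAuxiliary.exists_inner_map (hB : IsAuxiliary S B) (hsymm : IsSymmetricOp S)
    (hpos : IsStrictlyPositive S) {K : H ≃L[ℂ] H} (hK : KInvariant K S)
    (hinv : KInvariant K (extOp S hpos.isNonneg B)) (f : B.domain) :
    ∃ hf : K f ∈ B.domain, ∀ g : H, K g ∈ B.domain → ⟪K g, B ⟨K f, hf⟩⟫_ℂ = ⟪g, B f⟫_ℂ := by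
  obtain ⟨u, hu⟩ := exists_friedrichs_eq hsymm hpos (B f)
  have hmem : (u : H) + f ∈ extDomain S hpos.isNonneg B :=
    ⟨0, f, 0, u, 0, zero_mem _, hu, LinearPMap.map_zero _, by simp⟩
  rw [← extOp_domain hsymm hpos.isNonneg hB, ← hinv.mem_domain_iff,
    extOp_domain hsymm hpos.isNonneg hB] at hmem
  obtain ⟨f₀, f', η, u', v', hη, hu', hv', heq⟩ := hmem
  rw [map_add] at heq
  have hle := domain_le_friedrichsDomain hsymm hpos.isNonneg
  have hKu := hK.map_mem_friedrichsDomain hsymm hpos.isNonneg u.2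
  -- The left side lies in `ker S*`, the right side in `D(S_F)`.
  have hdiff : K f - f' = f₀ + u' + v' - K u := by
    rw [sub_eq_sub_iff_add_eq_add, add_comm, heq]
    abel
  have hz : K f - (f' : H) = 0 := by
    refine eq_zero_of_mem_friedrichsDomain_of_mem_kernel hsymm hpos ?_
      (sub_mem (hK.map_mem_kernel_adjoint hsymm.dense (hB.mem_kernel_adjoint f))
        (hB.mem_kernel_adjoint f'))
    rw [hdiff]
    exact sub_mem (add_mem (add_mem (hle f₀.2) u'.2) v'.2) hKu
  have hf' : K f = f' := sub_eq_zero.1 hz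
  have hKu_eq : K u = f₀ + u' + v' := (sub_eq_zero.1 (hdiff ▸ hz)).symm
  refine ⟨hf' ▸ f'.2, fun g hg => ?_⟩
  obtain ⟨hd, hadj⟩ := hK.adjoint hsymm.dense ⟨u, u.2.1⟩
  have hSle : S ≤ S† := LinearPMap.IsFormalAdjoint.le_adjoint hsymm.dense hsymm.symm
  have hsum : S† ⟨K u, hd⟩ = S f₀ + B f' + η := by
    have h1 : (⟨K u, hd⟩ : S†.domain) =
        ⟨f₀, hSle.1 f₀.2⟩ + ⟨u', u'.2.1⟩ + ⟨v', v'.2.1⟩ := Subtype.ext hKu_eq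
    rw [h1, LinearPMap.map_add, LinearPMap.map_add]
    refine congrArg₂ _ (congrArg₂ _ ?_ hu') hv'
    exact (hSle.2 rfl).symm
  have hBf : S† ⟨u, u.2.1⟩ = B f := hu
  obtain ⟨hgd, hgz⟩ := mem_kernel.1 (hB.mem_kernel_adjoint ⟨K g, hg⟩)
  -- Pairing with `K g ∈ D(B)` isolates `B f'`: `S f₀` is orthogonal to `ker S*`, and `η` to `D(B)`.
  have hS0 : ⟪K g, S f₀⟫_ℂ = 0 := by
    have := LinearPMap.adjoint_isFormalAdjoint hsymm.dense ⟨K g, hgd⟩ f₀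
    rw [hgz, inner_zero_left] at this
    exact this.symm
  have hη0 : ⟪K g, η⟫_ℂ = 0 := (Submodule.mem_orthogonal _ _).1 hη.1 _ hg
  have hval : (⟨K f, hf' ▸ f'.2⟩ : B.domain) = f' := Subtype.ext hf'
  rw [hval]
  have hinner : ⟪K g, S† ⟨K u, hd⟩⟫_ℂ = ⟪g, B f⟫_ℂ := by
    rw [hadj, ContinuousLinearMap.adjoint_inner_right, hBf]
    simp
  rw [← hinner, hsum, inner_add_right, inner_add_right, hS0, hη0, zero_add, add_zero]

/-- Root vectors of a form isometry outside the unit circle are null vectors of the form. -/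
theorem IsAuxiliary.apply_eq_zero_of_pow (hB : IsAuxiliary S B) (A : Module.End ℂ B.domain)
    (hA : ∀ f, quadForm B (A f) = quadForm B f) {ζ : ℂ} (hζ : ‖ζ‖ ≠ 1) (n : ℕ) :
    ∀ f : B.domain, ((A - algebraMap ℂ _ ζ) ^ n) f = 0 → B f = 0 := by
  induction n with
  | zero =>
    intro f hf
    rw [pow_zero, Module.End.one_apply] at hf
    rw [hf, LinearPMap.map_zero]
  | succ n ih =>
    intro f hf
    rw [pow_succ, Module.End.mul_apply] at hf
    have h0 := ih _ hf
    -- `A f` and `ζ f` differ by `(A - ζ) f`, which lies in `ker B` by induction and so does not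
    -- affect the form.
    have hq : quadForm B (A f) = quadForm B (ζ • f) := by
      have h1 : A f = ζ • f + (A - algebraMap ℂ _ ζ) f := by
        simp [Module.algebraMap_end_apply]
      have h2 : B (A f) = B (ζ • f) := by
        rw [h1, LinearPMap.map_add, h0, add_zero]
      rw [quadForm, quadForm, ← hB.symm, ← hB.symm, h2, h1, Submodule.coe_add, inner_add_right,
        hB.symm _ ((A - algebraMap ℂ _ ζ) f), h0, inner_zero_right, add_zero]
    rw [hA, quadForm_smul] at hq
    apply hB.apply_eq_zero
    have h4 : (‖ζ‖ ^ 2 - 1) * quadForm B f = 0 := by linarith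
    refine (mul_eq_zero.1 h4).resolve_left fun h => hζ ?_
    exact (pow_eq_one_iff_of_nonneg (norm_nonneg _) two_ne_zero).1 (sub_eq_zero.1 h)

end Auxiliary

end KInvExt

theorem mainTheorem7 {H : Type*} [NormedAddCommGroup H] [InnerProductSpace ℂ H] [CompleteSpace H]
    (K : H ≃L[ℂ] H) (S : H →ₗ.[ℂ] H)
    (hsymm : KInvExt.IsSymmetricOp S) (hclosed : S.IsClosed)
    (hpos : KInvExt.IsStrictlyPositive S) (hK : KInvExt.KInvariant K S)
    (hfin : FiniteDimensional ℂ (KInvExt.kernel S.adjoint))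
    (B : H →ₗ.[ℂ] H) (hB : KInvExt.IsAuxiliary S B)
    (hinv : KInvExt.KInvariant K (KInvExt.extOp S hpos.isNonneg B)) :
    ∃ hKB : ∀ f ∈ B.domain, (K : H →ₗ[ℂ] H) f ∈ B.domain,
      (KInvExt.nonunitaryRootSpan ((K : H →ₗ[ℂ] H).restrict hKB)).map B.domain.subtype
        ≤ KInvExt.kernel B := by
  have key := hB.exists_inner_map hsymm hpos hK hinv
  have hKB : ∀ f ∈ B.domain, (K : H →ₗ[ℂ] H) f ∈ B.domain := fun f hf => (key ⟨f, hf⟩).1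
  refine ⟨hKB, Submodule.map_mono (iSup₂_le fun ζ hζ f hf => ?_)⟩
  obtain ⟨n, hn⟩ := (Module.End.mem_maxGenEigenspace _ _ _).1 hf
  refine hB.apply_eq_zero_of_pow _ (fun g => ?_) hζ.2 n f hn
  -- Only the diagonal of the preserved sesquilinear form is needed.
  exact congrArg Complex.re ((key g).2 g (key g).1)
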